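/- Noncommutative Spitzer identity. Let $\mathbb K$ be a field of characteristic zero, $\theta\in\mathbb K$, $\theta\neq 0$, and let $A$ be an associative (not necessarily commutative or unital) $\mathbb K$-algebra with a linear map $P:A\to A$ satisfying the Rota–Baxter relation of weight $\theta$ $$P(x)P(y)+\theta P(xy)=P(xP(y))+P(P(x)y)\qquad(x,y\in A).$$ Assume that $(A,P)$ is complete filtered: there is a decreasing filtration $(A_n)_{n\ge 0}$ of $A$ by two-sided ideals with $P(A_n)\subseteq A_n$, $A_mA_n\subseteq A_{m+n}$, and such that the natural map $A\to\varprojlim A/A_n$ is bijective. All limits and infinite sums below are taken in the topology given by the filtration. Let $1$ be the unit of a unital algebra $U$ containing $A$ (for instance $U=A$ if $A$ is unital, and $A$ with a unit adjoined otherwise), and for $x\in A_1$ put $$\exp(x)=\sum_{n\ge 0}\frac{x^n}{n!}\in 1+A_1,\qquad \log(1+x)=\sum_{n\ge 1}\frac{(-1)^{n-1}x^n}{n}\in A_1 .$$ For $x,y\in A_1$ put $\mathrm{BCH}(x,y)=\log(\exp(x)\exp(y))-x-y$, and let $\tilde P=\theta\,\mathrm{id}_A-P$. For $a\in A_1$ let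 $\chi_\theta(a)$ be the limit of the sequence defined by $\chi_{(0)}(a)=a$ and $\chi_{(n+1)}(a)=a-\frac1\theta\mathrm{BCH}\big(P(\chi_{(n)}(a)),\tilde P(\chi_{(n)}(a))\big)$. Then for every $a\in A_1$ this limit exists, lies in $A_1$, and is the unique $c\in A_1$ with $c=a-\frac1\theta\mathrm{BCH}\big(P(c),\tilde P(c)\big)$. Moreover, for every $b\in A_1$, $$\exp\Big(-P\Big(\chi_\theta\Big(\frac{\log(1+\theta b)}{\theta}\Big)\Big)\Big)=\sum_{n=0}^\infty(-1)^n\underbrace{P\big(P(\cdots P(P}_{n\text{ times}}(b)\,b)\cdots b)\,b\big),$$ where the $n=0$ term is $1$, the $n=1$ term is $-P(b)$, the $n=2$ term is $P(P(b)b)$, and in general the $n$-fold expression is $P(w_{n-1}b)$ with $w_{n-1}$ the $(n-1)$-fold one; the series converges in the topology of the filtration. -/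

import Mathlib

namespace RotaBaxterSpitzer

section Convergence

variable {K V : Type*} [Field K] [AddCommGroup V] [Module K V]

/-- Convergence of a sequence in the topology whose neighbourhoods of `0` are the `F k`. -/
def FTendsto (F : ℕ → Submodule K V) (s : ℕ → V) (l : V) : Prop :=
  ∀ k, ∃ N, ∀ n, N ≤ n → l - s n ∈ F k

/-- The limit of a sequence in that topology (an arbitrary value if there is none). -/
noncomputable def flim (F : ℕ → Submodule K V) (s : ℕ → V) : V :=
  Classical.epsilon fun l => FTendsto F s l

end Convergence

section Algebra

variable {K A : Type*} [Field K] [NonUnitalRing A] [Module K A]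

/-- The Rota--Baxter relation of weight `θ`. -/
def IsRotaBaxter (θ : K) (P : A →ₗ[K] A) : Prop :=
  ∀ x y : A, P x * P y + θ • P (x * y) = P (x * P y) + P (P x * y)

/-- A complete decreasing filtration of `A` by subalgebras with `A_m A_n ⊆ A_{m+n}`. The last
field says that the natural map from `A` to the inverse limit of the `A / A_n` is a bijection. -/
structure IsCompleteFiltration (F : ℕ → Submodule K A) : Prop where
  antitone : Antitone F
  mul_mem : ∀ {m n : ℕ} {x y : A}, x ∈ F m → y ∈ F n → x * y ∈ F (m + n)
  complete : ∀ s : ℕ → A, (∀ n, s (n + 1) - s n ∈ F n) → ∃! l : A, ∀ n, l - s n ∈ F n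

/-- `(A, P)` with the filtration `F` is a complete filtered Rota--Baxter algebra of weight `θ`:
the filtration is complete and consists of Rota--Baxter ideals, that is, of two-sided ideals
mapped into themselves by `P`. -/
structure IsCompleteFilteredRotaBaxter (θ : K) (P : A →ₗ[K] A) (F : ℕ → Submodule K A) : Prop
    extends IsCompleteFiltration F where
  rotaBaxter : IsRotaBaxter θ P
  ideal_left : ∀ (n : ℕ) (x y : A), y ∈ F n → x * y ∈ F n
  ideal_right : ∀ (n : ℕ) (x y : A), x ∈ F n → x * y ∈ F n
  map_mem : ∀ (n : ℕ) (x : A), x ∈ F n → P x ∈ F n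

end Algebra

section ExpLog

/-! `A` need not have a unit. The `1` in `exp` and `log` is that of a unital algebra `U` that
contains `A` through `ι`: one may take `U = A` if `A` has a unit, and otherwise `A` with a unit
adjoined. -/

variable {K A U : Type*} [Field K] [NonUnitalRing A] [Module K A] [Ring U] [Algebra K U]

/-- The filtration of `A`, seen in `U`. -/
def filtIn (ι : A →ₙₐ[K] U) (F : ℕ → Submodule K A) (k : ℕ) : Submodule K U :=
  (F k).map (ι : A →ₗ[K] U)

/-- Partial sums of `exp a = ∑ aⁿ / n!`. -/
noncomputable def expSum (ι : A →ₙₐ[K] U) (a : A) (N : ℕ) : U :=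
  ∑ n ∈ Finset.range N, ((n.factorial : K)⁻¹) • ι a ^ n

/-- `exp : A₁ → 1 + A₁`. -/
noncomputable def fexp (ι : A →ₙₐ[K] U) (F : ℕ → Submodule K A) (a : A) : U :=
  flim (filtIn ι F) (expSum ι a)

/-- Partial sums of `log u = ∑_{n ≥ 1} (-1)ⁿ⁻¹ (u - 1)ⁿ / n`. -/
noncomputable def logSum (K : Type*) {U : Type*} [Field K] [Ring U] [Algebra K U]
    (u : U) (N : ℕ) : U :=
  ∑ n ∈ Finset.range N, ((-1 : K) ^ n / ((n : K) + 1)) • (u - 1) ^ (n + 1)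

/-- `log : 1 + A₁ → A₁`. -/
noncomputable def flog (ι : A →ₙₐ[K] U) (F : ℕ → Submodule K A) (u : U) : A :=
  Classical.epsilon fun l : A => FTendsto (filtIn ι F) (logSum K u) (ι l)

/-- `BCH(x, y)`, where `exp x * exp y = exp (x + y + BCH(x, y))`, for `x, y ∈ A₁`. -/
noncomputable def bch (ι : A →ₙₐ[K] U) (F : ℕ → Submodule K A) (x y : A) : A :=
  flog ι F (fexp ι F x * fexp ι F y) - x - y

/-- The map `c ↦ a - θ⁻¹ BCH(P c, P̃ c)`, with `P̃ = θ id - P`. -/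
noncomputable def chiStep (ι : A →ₙₐ[K] U) (F : ℕ → Submodule K A) (θ : K) (P : A →ₗ[K] A)
    (a c : A) : A :=
  a - θ⁻¹ • bch ι F (P c) (θ • c - P c)

/-- The iterates of the recursion of weight `θ`, starting at `a`. -/
noncomputable def chiIter (ι : A →ₙₐ[K] U) (F : ℕ → Submodule K A) (θ : K) (P : A →ₗ[K] A)
    (a : A) : ℕ → A
  | 0 => a
  | n + 1 => chiStep ι F θ P a (chiIter ι F θ P a n)

/-- The `BCH`-recursion of weight `θ`, the limit of its iterates. -/
noncomputable def chi (ι : A →ₙₐ[K] U) (F : ℕ → Submodule K A) (θ : K) (P : A →ₗ[K] A)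
    (a : A) : A :=
  flim F (chiIter ι F θ P a)

/-- `P(P(⋯P(P(b) b)⋯ b) b)` with `n + 1` applications of `P`. -/
def nestedP (P : A →ₗ[K] A) (b : A) : ℕ → A
  | 0 => P b
  | n + 1 => P (nestedP P b n * b)

/-- The same with `n` applications of `P`, in `U`; it is `1` for `n = 0`. -/
def spitzerTerm (ι : A →ₙₐ[K] U) (P : A →ₗ[K] A) (b : A) : ℕ → U
  | 0 => 1
  | n + 1 => ι (nestedP P b n)

end ExpLog

section WellDefined

/-! The series for `exp` on `A₁` and for `log` on `1 + A₁` converge. -/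

variable {K A U : Type*} [Field K] [NonUnitalRing A] [Module K A] [Ring U] [Algebra K U]

theorem pow_mem_filtIn {ι : A →ₙₐ[K] U} {F : ℕ → Submodule K A} (hF : IsCompleteFiltration F)
    {a : A} (ha : a ∈ F 1) (n : ℕ) : ∃ x ∈ F (n + 1), ι x = ι a ^ (n + 1) := by
  induction n with
  | zero => exact ⟨a, ha, by simp⟩
  | succ n ih =>
    obtain ⟨x, hx, hxe⟩ := ih
    exact ⟨x * a, hF.mul_mem hx ha, by rw [map_mul, hxe, pow_succ _ (n + 1)]⟩

theorem series_converges {ι : A →ₙₐ[K] U} {F : ℕ → Submodule K A}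
    (hF : IsCompleteFiltration F) {a : A} (ha : a ∈ F 1) (c : ℕ → K) :
    ∃ l ∈ F 1, FTendsto (filtIn ι F)
      (fun N => ∑ n ∈ Finset.range N, c n • ι a ^ (n + 1)) (ι l) := by
  choose x hx hxe using pow_mem_filtIn (ι := ι) hF ha
  set s : ℕ → A := fun N => ∑ n ∈ Finset.range N, c n • x n with hs
  have hs1 : ∀ N, s N ∈ F 1 := fun N =>
    Submodule.sum_mem _ fun n _ => Submodule.smul_mem _ _ (hF.antitone (by omega) (hx n))
  obtain ⟨l, hl, -⟩ := hF.complete s (fun n => by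
    rw [hs]
    simp only [Finset.sum_range_succ, add_sub_cancel_left]
    exact Submodule.smul_mem _ _ (hF.antitone (by omega) (hx n)))
  refine ⟨l, ?_, fun k => ⟨k, fun n hn => ⟨l - s n, hF.antitone hn (hl n), ?_⟩⟩⟩
  · have := Submodule.add_mem _ (hl 1) (hs1 1)
    rwa [sub_add_cancel] at this
  · have : ι (s n) = ∑ i ∈ Finset.range n, c i • ι a ^ (i + 1) := by
      simp only [hs, map_sum, map_smul, hxe]
    simp [map_sub, this]

theorem fexp_spec {ι : A →ₙₐ[K] U} {F : ℕ → Submodule K A} (hF : IsCompleteFiltration F)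
    {a : A} (ha : a ∈ F 1) : FTendsto (filtIn ι F) (expSum ι a) (fexp ι F a) := by
  refine Classical.epsilon_spec (p := fun l => FTendsto (filtIn ι F) (expSum ι a) l) ?_
  obtain ⟨l, -, hl⟩ := series_converges (ι := ι) hF ha (fun n => (((n + 1).factorial : K)⁻¹))
  refine ⟨1 + ι l, fun k => ?_⟩
  obtain ⟨N, hN⟩ := hl k
  refine ⟨N + 1, fun n hn => ?_⟩
  obtain ⟨m, rfl⟩ : ∃ m, n = m + 1 := ⟨n - 1, by omega⟩
  have := hN m (by omega)
  simp only [expSum, Finset.sum_range_succ', pow_zero, Nat.factorial_zero, Nat.cast_one, inv_one,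
    one_smul]
  rwa [add_comm (1 : U), add_sub_add_right_eq_sub]

theorem flog_spec {ι : A →ₙₐ[K] U} {F : ℕ → Submodule K A} (hF : IsCompleteFiltration F)
    {a : A} (ha : a ∈ F 1) :
    FTendsto (filtIn ι F) (logSum K (1 + ι a)) (ι (flog ι F (1 + ι a))) := by
  refine Classical.epsilon_spec
    (p := fun l : A => FTendsto (filtIn ι F) (logSum K (1 + ι a)) (ι l)) ?_
  obtain ⟨l, -, hl⟩ := series_converges (ι := ι) hF ha (fun n => (-1 : K) ^ n / ((n : K) + 1))
  refine ⟨l, ?_⟩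
  have : logSum K (1 + ι a) = fun N => ∑ n ∈ Finset.range N,
      ((-1 : K) ^ n / ((n : K) + 1)) • ι a ^ (n + 1) := by
    funext N
    simp [logSum]
  rw [this]
  exact hl

end WellDefined

end RotaBaxterSpitzer

/-! The step map of the recursion is a contraction: `BCH` has no linear part, so inputs agreeing
modulo `F k` give values agreeing modulo `F (k + 1)` (`bch_sub_bch_mem`). Completeness then yields
the limit `c` and its uniqueness as a fixed point. Since `P c + P̃ c = θ c`, the fixed point
equation is the factorization `exp (P c) * exp (P̃ c) = exp (θ a)` (`fexp_mul_fexp_chi`), and for `a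
= θ⁻¹ log (1 + θ b)` the right side is `1 + θ b`.

By the Rota–Baxter relation, `P` and `-P̃` are multiplicative from the double product `x P(y) + P(x)
y - θ x y` to the product of `A`. With `1 + w` the double product exponential of `-c`, this gives
`exp (-P c) = 1 + P w` and `exp (P̃ c) = 1 - P̃ w` (`exists_fexp_eq`). Substituting in `exp (P̃ c) =
exp (-P c) * (1 + θ b)` and cancelling `θ` leaves `w = -b - P(w) b`. Applying `P` and iterating the
equation for `P w` produces the series (`spitzer_series_tendsto`). -/

namespace RotaBaxterSpitzer

/-! ### Truncated exponential and logarithm as polynomials. -/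

section Polynomials

open Polynomial

variable {K : Type*} [Field K] [CharZero K]

/-- The exponential series truncated below degree `N`. -/
noncomputable def expPoly (K : Type*) [Field K] (N : ℕ) : K[X] :=
  ∑ n ∈ Finset.range N, C ((n.factorial : K)⁻¹) * X ^ n

/-- The series of `log (1 + X)` truncated after degree `N`. -/
noncomputable def logPoly (K : Type*) [Field K] (N : ℕ) : K[X] :=
  ∑ n ∈ Finset.range N, C ((-1 : K) ^ n / ((n : K) + 1)) * X ^ (n + 1)

theorem derivative_expPoly_succ (N : ℕ) : derivative (expPoly K (N + 1)) = expPoly K N := by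
  simp only [expPoly, derivative_sum, Finset.sum_range_succ' _ N, derivative_add]
  simp only [derivative_C_mul, derivative_X_pow, pow_zero, derivative_one, mul_zero, add_zero,
    Nat.add_sub_cancel, ← mul_assoc, ← C_mul]
  refine Finset.sum_congr rfl fun n _ => ?_
  congr 2
  have h1 : ((n : K) + 1) ≠ 0 := by exact_mod_cast n.succ_ne_zero
  have h2 : (n.factorial : K) ≠ 0 := by exact_mod_cast n.factorial_ne_zero
  rw [Nat.factorial_succ]
  push_cast
  field_simp

theorem derivative_logPoly (N : ℕ) : derivative (logPoly K N) = ∑ n ∈ Finset.range N, (-X) ^ n := by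
  simp only [logPoly, derivative_sum]
  refine Finset.sum_congr rfl fun n _ => ?_
  have h1 : ((n : K) + 1) ≠ 0 := by exact_mod_cast n.succ_ne_zero
  rw [derivative_C_mul, derivative_X_pow, Nat.add_sub_cancel, ← mul_assoc, ← C_mul,
    Nat.cast_succ, div_mul_cancel₀ _ h1, neg_pow (X : K[X]), C_pow, C_neg, C_1]

theorem X_dvd_logPoly (K : Type*) [Field K] (N : ℕ) : X ∣ logPoly K N :=
  Finset.dvd_sum fun n _ => Dvd.intro_left _ (by rw [pow_succ, mul_assoc])

/-- The differential equation is the recursion `(n + 1) p_{n+1} = (1 - n) p_n`, which gives `p_1 =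
1` and stops at `n = 1`; characteristic zero allows division by `n + 1`. -/
theorem coeff_eq_of_differential_equation {p : K[X]} {M : ℕ} (h0 : p.coeff 0 = 1)
    (h : X ^ M ∣ (1 + X) * derivative p - p) : X ^ (M + 1) ∣ p - (1 + X) := by
  rw [X_pow_dvd_iff] at h ⊢
  intro d hd
  induction d with
  | zero => simp [h0]
  | succ n ih =>
    have hn := h n (by omega)
    have ihn := ih (by omega)
    have hc : ((n : K) + 1) ≠ 0 := by exact_mod_cast n.succ_ne_zero
    rw [coeff_sub, sub_eq_zero] at ihn ⊢
    rw [add_mul, one_mul, coeff_sub, coeff_add, coeff_derivative] at hn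
    rcases n with _ | n
    · simp [coeff_one, h0] at hn ⊢
      linear_combination hn
    · rw [coeff_X_mul, coeff_derivative] at hn
      rcases n with _ | n
      · simp [coeff_one, coeff_X] at hn ihn ⊢
        exact hn
      · simp [coeff_one, coeff_X] at hn ihn ⊢
        rw [ihn] at hn
        rcases mul_eq_zero.1 (by linear_combination hn :
          p.coeff (n + 1 + 1 + 1) * ((n : K) + 1 + 1 + 1) = 0) with h | h
        · exact h
        · exact absurd h (by exact_mod_cast (n + 2).succ_ne_zero)

/-- The composite solves `(1 + X) p' = p` up to two truncation errors, one from each series, both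
divisible by the required power of `X`. -/
theorem X_pow_dvd_expPoly_comp_logPoly (N : ℕ) :
    X ^ N ∣ (expPoly K N).comp (logPoly K N) - (1 + X) := by
  rcases N with _ | M
  · simp
  obtain ⟨q, hq⟩ := X_dvd_logPoly K (M + 1)
  have hE : (expPoly K (M + 1)).comp (logPoly K (M + 1)) =
      (expPoly K M).comp (logPoly K (M + 1)) +
        C ((M.factorial : K)⁻¹) * logPoly K (M + 1) ^ M := by
    rw [expPoly, Finset.sum_range_succ, ← expPoly]
    simp
  apply coeff_eq_of_differential_equation
  · rw [coeff_zero_eq_eval_zero, eval_comp, hq]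
    simp [expPoly, Finset.sum_range_succ', eval_finsetSum]
  · have hg : (1 + X) * derivative (logPoly K (M + 1)) = 1 - (-X) ^ (M + 1) := by
      rw [derivative_logPoly, ← mul_neg_geom_sum]
      ring
    rw [derivative_comp, derivative_expPoly_succ, ← mul_assoc, hg, hE]
    refine ⟨-((-1) ^ (M + 1) * X * (expPoly K M).comp (logPoly K (M + 1)))
      - C ((M.factorial : K)⁻¹) * q ^ M, ?_⟩
    generalize (expPoly K M).comp (logPoly K (M + 1)) = e
    rw [hq, mul_pow, neg_pow (X : K[X])]
    ring

/-- The constant term is zero, and the derivative cancels except for the top terms of the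
truncations. -/
theorem X_pow_dvd_expPoly_neg_mul_expPoly (N : ℕ) :
    X ^ N ∣ (expPoly K N).comp (-X) * expPoly K N - 1 := by
  rcases N with _ | M
  · simp
  set p := (expPoly K (M + 1)).comp (-X) * expPoly K (M + 1) - 1 with hp
  have h0 : p.coeff 0 = 0 := by
    rw [coeff_zero_eq_eval_zero, hp]
    simp [expPoly, Finset.sum_range_succ', eval_finsetSum]
  have hd : X ^ M ∣ derivative p := by
    have hE : expPoly K (M + 1) = expPoly K M + C ((M.factorial : K)⁻¹) * X ^ M := by
      rw [expPoly, Finset.sum_range_succ, ← expPoly]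
    rw [hp, derivative_sub, derivative_mul, derivative_comp, derivative_expPoly_succ, hE]
    refine ⟨C ((M.factorial : K)⁻¹) *
      ((-1) ^ M * expPoly K M - (expPoly K M).comp (-X)), ?_⟩
    simp only [add_comp, mul_comp, C_comp, pow_comp, X_comp, derivative_neg, derivative_X,
      derivative_one]
    rw [neg_pow (X : K[X])]
    ring
  rw [X_pow_dvd_iff] at hd ⊢
  rintro (_ | n) hn
  · exact h0
  · have := hd n (by omega)
    rw [coeff_derivative] at this
    exact (mul_eq_zero.1 this).resolve_right (by exact_mod_cast n.succ_ne_zero)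

end Polynomials

/-! ### Power series in a filtered algebra. -/

section Filtration

variable {K U : Type*} [Field K] [Ring U] [Algebra K U]

/-- A separated decreasing filtration with `G m * G n ⊆ G (m + n)`. -/
structure IsMulFiltration (G : ℕ → Submodule K U) : Prop where
  antitone : Antitone G
  mul_mem : ∀ {m n : ℕ} {x y : U}, x ∈ G m → y ∈ G n → x * y ∈ G (m + n)
  separated : ∀ x, (∀ n, x ∈ G n) → x = 0

theorem FTendsto.unique {V : Type*} [AddCommGroup V] [Module K V] {F : ℕ → Submodule K V}
    (hF : ∀ x, (∀ n, x ∈ F n) → x = 0) {s : ℕ → V} {l l' : V} (h : FTendsto F s l)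
    (h' : FTendsto F s l') : l = l' := by
  refine sub_eq_zero.1 (hF _ fun k => ?_)
  obtain ⟨N, hN⟩ := h k
  obtain ⟨N', hN'⟩ := h' k
  have := sub_mem (hN (max N N') (le_max_left _ _)) (hN' (max N N') (le_max_right _ _))
  rwa [sub_sub_sub_cancel_right] at this

namespace IsMulFiltration

variable {G : ℕ → Submodule K U}

theorem pow_mem (hG : IsMulFiltration G) {x : U} (hx : x ∈ G 1) (n : ℕ) :
    x ^ (n + 1) ∈ G (n + 1) := by
  induction n with
  | zero => simpa using hx
  | succ n ih =>
    rw [pow_succ]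
    exact hG.mul_mem ih hx

theorem aeval_mem (hG : IsMulFiltration G) {x : U} (hx : x ∈ G 1) {N : ℕ} {p : Polynomial K}
    (hp : Polynomial.X ^ (N + 1) ∣ p) : Polynomial.aeval x p ∈ G (N + 1) := by
  obtain ⟨q, rfl⟩ := hp
  rw [Polynomial.aeval_eq_sum_range]
  refine Submodule.sum_mem _ fun i _ => ?_
  rw [Polynomial.coeff_X_pow_mul']
  split_ifs with h
  · obtain ⟨j, rfl⟩ : ∃ j, i = j + 1 := ⟨i - 1, by omega⟩
    exact Submodule.smul_mem _ _ (hG.antitone h (hG.pow_mem hx j))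
  · simp

theorem pow_sub_pow_mem (hG : IsMulFiltration G) {x y : U} (hx : x ∈ G 1) (hy : y ∈ G 1)
    {k : ℕ} (h : x - y ∈ G k) (n : ℕ) : x ^ (n + 1) - y ^ (n + 1) ∈ G (n + k) := by
  induction n with
  | zero => simpa using h
  | succ n ih =>
    have e : x ^ (n + 1 + 1) - y ^ (n + 1 + 1) =
        (x ^ (n + 1) - y ^ (n + 1)) * x + y ^ (n + 1) * (x - y) := by
      rw [pow_succ x (n + 1), pow_succ y (n + 1)]
      noncomm_ring
    rw [e]
    refine add_mem (hG.antitone (by omega) (hG.mul_mem ih hx))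
      (hG.antitone (by omega) (hG.mul_mem (hG.pow_mem hy n) h))

theorem limit_mem (hG : IsMulFiltration G) {x l : U} (hx : x ∈ G 1) {c : ℕ → K}
    (h : FTendsto G (fun N => ∑ n ∈ Finset.range N, c n • x ^ (n + 1)) l) : l ∈ G 1 := by
  obtain ⟨N, hN⟩ := h 1
  have := add_mem (hN N le_rfl) (Submodule.sum_mem (G 1) fun n (_ : n ∈ Finset.range N) =>
    Submodule.smul_mem _ (c n) (hG.antitone (by omega) (hG.pow_mem hx n)))
  simpa using this

/-- A power series with linear coefficient `1` is the identity to first order. -/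
theorem limit_sub_limit_mem (hG : IsMulFiltration G) {x y l m : U} (hx : x ∈ G 1) (hy : y ∈ G 1)
    {c : ℕ → K} (hc : c 0 = 1)
    (hl : FTendsto G (fun N => ∑ n ∈ Finset.range N, c n • x ^ (n + 1)) l)
    (hm : FTendsto G (fun N => ∑ n ∈ Finset.range N, c n • y ^ (n + 1)) m)
    {k : ℕ} (h : x - y ∈ G k) : l - m - (x - y) ∈ G (k + 1) := by
  obtain ⟨N, hN⟩ := hl (k + 1)
  obtain ⟨M, hM⟩ := hm (k + 1)
  have h1 := hN (N + M + 1) (by omega)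
  have h2 := hM (N + M + 1) (by omega)
  -- The linear term contributes exactly `x - y`; each higher power gains at least one degree.
  have h3 : ∑ n ∈ Finset.range (N + M), c (n + 1) • (x ^ (n + 1 + 1) - y ^ (n + 1 + 1)) ∈
      G (k + 1) :=
    Submodule.sum_mem _ fun n _ => Submodule.smul_mem _ _
      (hG.antitone (by omega) (hG.pow_sub_pow_mem hx hy h (n + 1)))
  have := add_mem (sub_mem h1 h2) h3
  simp only [Finset.sum_range_succ' _ (N + M), hc, one_smul, zero_add, pow_one, smul_sub,
    Finset.sum_sub_distrib] at this
  convert this using 1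
  abel

end IsMulFiltration

end Filtration

/-! ### Identities for the exponential and logarithm. -/

section ExpLogIdentities

variable {K A U : Type*} [Field K] [NonUnitalRing A] [Module K A] [Ring U] [Algebra K U]
  {ι : A →ₙₐ[K] U} {F : ℕ → Submodule K A}

theorem IsCompleteFiltration.separated (hF : IsCompleteFiltration F) (x : A)
    (hx : ∀ n, x ∈ F n) : x = 0 :=
  (hF.complete (fun _ => 0) fun n => by simp).unique (by simpa using hx) (by simp)

theorem map_mem_filtIn {k : ℕ} {x : A} (hx : x ∈ F k) : ι x ∈ filtIn ι F k :=
  ⟨x, hx, rfl⟩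

theorem map_mem_filtIn_iff (hι : Function.Injective ι) {k : ℕ} {x : A} :
    ι x ∈ filtIn ι F k ↔ x ∈ F k := by
  refine ⟨?_, map_mem_filtIn⟩
  rintro ⟨y, hy, hxy⟩
  rwa [← hι hxy]

theorem isMulFiltration_filtIn (hι : Function.Injective ι) (hF : IsCompleteFiltration F) :
    IsMulFiltration (filtIn ι F) where
  antitone _ _ h := Submodule.map_mono (hF.antitone h)
  mul_mem := by
    rintro m n _ _ ⟨x, hx, rfl⟩ ⟨y, hy, rfl⟩
    exact ⟨x * y, hF.mul_mem hx hy, map_mul ι x y⟩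
  separated := by
    intro x hx
    obtain ⟨y, -, rfl⟩ := hx 0
    rw [hF.separated y fun n => (map_mem_filtIn_iff hι).1 (hx n)]
    exact map_zero ι

theorem expSum_eq_aeval (a : A) (N : ℕ) :
    expSum ι a N = Polynomial.aeval (ι a) (expPoly K N) := by
  simp [expSum, expPoly, Algebra.smul_def]

theorem logSum_eq_aeval (x : U) (N : ℕ) :
    logSum K (1 + x) N = Polynomial.aeval x (logPoly K N) := by
  simp [logSum, logPoly, Algebra.smul_def]

theorem fexp_sub_one_tendsto (hF : IsCompleteFiltration F) {a : A} (ha : a ∈ F 1) :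
    FTendsto (filtIn ι F)
      (fun N => ∑ n ∈ Finset.range N, (((n + 1).factorial : K)⁻¹) • ι a ^ (n + 1))
      (fexp ι F a - 1) := by
  intro k
  obtain ⟨N, hN⟩ := fexp_spec (ι := ι) hF ha k
  refine ⟨N, fun n hn => ?_⟩
  have := hN (n + 1) (by omega)
  simp only [expSum, Finset.sum_range_succ', pow_zero, Nat.factorial_zero, Nat.cast_one, inv_one,
    one_smul] at this
  rwa [sub_sub, add_comm (1 : U)]

theorem flog_tendsto (hF : IsCompleteFiltration F) {a : A} (ha : a ∈ F 1) :
    FTendsto (filtIn ι F)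
      (fun N => ∑ n ∈ Finset.range N, ((-1 : K) ^ n / ((n : K) + 1)) • ι a ^ (n + 1))
      (ι (flog ι F (1 + ι a))) := by
  have := flog_spec (ι := ι) hF ha
  simpa only [logSum, add_sub_cancel_left, FTendsto] using this

theorem fexp_sub_one_mem (hι : Function.Injective ι) (hF : IsCompleteFiltration F) {a : A}
    (ha : a ∈ F 1) : fexp ι F a - 1 ∈ filtIn ι F 1 :=
  (isMulFiltration_filtIn hι hF).limit_mem (map_mem_filtIn ha) (fexp_sub_one_tendsto hF ha)

theorem flog_mem (hι : Function.Injective ι) (hF : IsCompleteFiltration F) {a : A}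
    (ha : a ∈ F 1) : flog ι F (1 + ι a) ∈ F 1 :=
  (map_mem_filtIn_iff hι).1
    ((isMulFiltration_filtIn hι hF).limit_mem (map_mem_filtIn ha) (flog_tendsto hF ha))

theorem fexp_sub_fexp_mem (hι : Function.Injective ι) (hF : IsCompleteFiltration F) {a b : A}
    (ha : a ∈ F 1) (hb : b ∈ F 1) {k : ℕ} (h : a - b ∈ F k) :
    fexp ι F a - fexp ι F b - ι (a - b) ∈ filtIn ι F (k + 1) := by
  have := (isMulFiltration_filtIn hι hF).limit_sub_limit_mem (map_mem_filtIn ha)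
    (map_mem_filtIn hb) (by simp) (fexp_sub_one_tendsto hF ha) (fexp_sub_one_tendsto hF hb)
    (by rw [← map_sub]; exact map_mem_filtIn h)
  rwa [sub_sub_sub_cancel_right, ← map_sub] at this

theorem flog_sub_flog_mem (hι : Function.Injective ι) (hF : IsCompleteFiltration F) {a b : A}
    (ha : a ∈ F 1) (hb : b ∈ F 1) {k : ℕ} (h : a - b ∈ F k) :
    flog ι F (1 + ι a) - flog ι F (1 + ι b) - (a - b) ∈ F (k + 1) := by
  have := (isMulFiltration_filtIn hι hF).limit_sub_limit_mem (map_mem_filtIn ha)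
    (map_mem_filtIn hb) (by simp) (flog_tendsto hF ha) (flog_tendsto hF hb)
    (by rw [← map_sub]; exact map_mem_filtIn h)
  rwa [← map_sub, ← map_sub, ← map_sub, map_mem_filtIn_iff hι] at this

/-- Modulo `filtIn ι F k` the logarithm may be replaced by a partial sum inside the truncated
exponential, which reduces the claim to the polynomial congruence. -/
theorem fexp_flog [CharZero K] (hι : Function.Injective ι) (hF : IsCompleteFiltration F) {a : A}
    (ha : a ∈ F 1) : fexp ι F (flog ι F (1 + ι a)) = 1 + ι a := by
  have hG := isMulFiltration_filtIn hι hF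
  refine (fexp_spec hF (flog_mem hι hF ha)).unique hG.separated fun k => ?_
  obtain ⟨N, hN⟩ := flog_spec (ι := ι) hF ha k
  refine ⟨N + k + 1, fun n hn => ?_⟩
  obtain ⟨m, rfl⟩ : ∃ m, n = m + 1 := ⟨n - 1, by omega⟩
  have hl := hN (m + 1) (by omega)
  have hL : logSum K (1 + ι a) (m + 1) ∈ filtIn ι F 1 := by
    simp only [logSum, add_sub_cancel_left]
    exact Submodule.sum_mem _ fun i _ => Submodule.smul_mem _ _
      (hG.antitone (by omega) (hG.pow_mem (map_mem_filtIn ha) i))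
  have h1 : ∑ i ∈ Finset.range m, (((i + 1).factorial : K)⁻¹) •
      (ι (flog ι F (1 + ι a)) ^ (i + 1) - logSum K (1 + ι a) (m + 1) ^ (i + 1)) ∈
        filtIn ι F k :=
    Submodule.sum_mem _ fun i _ => Submodule.smul_mem _ _ (hG.antitone (by omega)
      (hG.pow_sub_pow_mem (map_mem_filtIn (flog_mem hι hF ha)) hL hl i))
  have h2 := hG.antitone (show k ≤ m + 1 by omega)
    (hG.aeval_mem (map_mem_filtIn ha) (X_pow_dvd_expPoly_comp_logPoly (K := K) (m + 1)))
  rw [map_sub, Polynomial.aeval_comp, ← logSum_eq_aeval, map_add, Polynomial.aeval_X,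
    map_one] at h2
  have := neg_mem (add_mem h1 h2)
  convert this using 1
  simp only [expSum, expPoly, Finset.sum_range_succ' _ m, map_add, map_sum, map_mul,
    Polynomial.aeval_C, map_pow, Polynomial.aeval_X, pow_zero, Algebra.smul_def, mul_sub,
    Finset.sum_sub_distrib]
  simp only [Nat.factorial_zero, Nat.cast_one, inv_one, map_one, mul_one]
  abel

theorem fexp_neg_mul_fexp [CharZero K] (hι : Function.Injective ι)
    (hF : IsCompleteFiltration F) {a : A} (ha : a ∈ F 1) :
    fexp ι F (-a) * fexp ι F a = 1 := by
  have hG := isMulFiltration_filtIn hι hF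
  -- Precision `k + 1` puts the truncation error in degree at least `1`, so that the partial sum
  -- minus `1` does lie in `filtIn ι F 1` (`hT`).
  refine sub_eq_zero.1 (hG.separated _ fun k => hG.antitone (Nat.le_succ k) ?_)
  obtain ⟨N, hN⟩ := fexp_spec (ι := ι) hF ha (k + 1)
  obtain ⟨M, hM⟩ := fexp_spec (ι := ι) hF (neg_mem ha) (k + 1)
  have h1 := hN (N + M + k + 1) (by omega)
  have h2 := hM (N + M + k + 1) (by omega)
  have h3 := hG.antitone (show k + 1 ≤ N + M + k + 1 by omega)
    (hG.aeval_mem (map_mem_filtIn ha) (X_pow_dvd_expPoly_neg_mul_expPoly (K := K) (N + M + k + 1)))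
  rw [map_sub, map_mul, Polynomial.aeval_comp, map_neg, Polynomial.aeval_X, map_one, ← map_neg,
    ← expSum_eq_aeval, ← expSum_eq_aeval] at h3
  generalize expSum ι a (N + M + k + 1) = S at h1 h3
  generalize expSum ι (-a) (N + M + k + 1) = T at h2 h3
  have he := fexp_sub_one_mem hι hF ha
  have hT := sub_mem (fexp_sub_one_mem hι hF (neg_mem ha)) (hG.antitone (by omega) h2)
  have h4 := hG.antitone (show k + 1 ≤ k + 1 + 1 by omega) (hG.mul_mem h2 he)
  have h5 := hG.antitone (show k + 1 ≤ 1 + (k + 1) by omega) (hG.mul_mem hT h1)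
  convert add_mem (add_mem h3 (add_mem h1 h2)) (add_mem h4 h5) using 1
  noncomm_ring

end ExpLogIdentities

/-! ### The `BCH` recursion as a contraction. -/

section Recursion

variable {K A U : Type*} [Field K] [NonUnitalRing A] [Module K A] [Ring U] [Algebra K U]
  {ι : A →ₙₐ[K] U} {F : ℕ → Submodule K A}

theorem exists_fexp_mul_fexp (hι : Function.Injective ι) (hF : IsCompleteFiltration F) {x y : A}
    (hx : x ∈ F 1) (hy : y ∈ F 1) : ∃ g ∈ F 1, fexp ι F x * fexp ι F y = 1 + ι g := by
  obtain ⟨e, he, hex⟩ := fexp_sub_one_mem hι hF hx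
  obtain ⟨f, hf, hfy⟩ := fexp_sub_one_mem hι hF hy
  refine ⟨e + f + e * f, add_mem (add_mem he hf) (hF.antitone (by omega) (hF.mul_mem he hf)), ?_⟩
  change ι e = _ at hex
  change ι f = _ at hfy
  rw [map_add, map_add, map_mul, hex, hfy]
  noncomm_ring

theorem bch_mem (hι : Function.Injective ι) (hF : IsCompleteFiltration F) {x y : A}
    (hx : x ∈ F 1) (hy : y ∈ F 1) : bch ι F x y ∈ F 1 := by
  obtain ⟨g, hg, h⟩ := exists_fexp_mul_fexp hι hF hx hy
  rw [bch, h]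
  exact sub_mem (sub_mem (flog_mem hι hF hg) hx) hy

/-- To first order `log (exp x * exp y)` changes by `(x - x') + (y - y')`, which the subtracted `x`
and `y` cancel. -/
theorem bch_sub_bch_mem (hι : Function.Injective ι) (hF : IsCompleteFiltration F)
    {x y x' y' : A} (hx : x ∈ F 1) (hy : y ∈ F 1) (hx' : x' ∈ F 1) (hy' : y' ∈ F 1) {k : ℕ}
    (hxx : x - x' ∈ F k) (hyy : y - y' ∈ F k) : bch ι F x y - bch ι F x' y' ∈ F (k + 1) := by
  have hG := isMulFiltration_filtIn hι hF
  obtain ⟨g, hg, h⟩ := exists_fexp_mul_fexp hι hF hx hy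
  obtain ⟨g', hg', h'⟩ := exists_fexp_mul_fexp hι hF hx' hy'
  have h1 := fexp_sub_fexp_mem hι hF hx hx' hxx
  have h2 := fexp_sub_fexp_mem hι hF hy hy' hyy
  have hd1 := add_mem (hG.antitone (Nat.le_succ k) h1) (map_mem_filtIn (ι := ι) hxx)
  have hd2 := add_mem (hG.antitone (Nat.le_succ k) h2) (map_mem_filtIn (ι := ι) hyy)
  rw [sub_add_cancel] at hd1 hd2
  have h3 := hG.mul_mem hd1 (fexp_sub_one_mem hι hF hy)
  have h4 := hG.antitone (show k + 1 ≤ 1 + k by omega) (hG.mul_mem (fexp_sub_one_mem hι hF hx') hd2)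
  have h5 : g - g' - (x - x') - (y - y') ∈ F (k + 1) := by
    rw [← map_mem_filtIn_iff hι]
    convert add_mem (add_mem h1 h2) (add_mem h3 h4) using 1
    rw [map_sub, map_sub, map_sub ι g, eq_sub_of_add_eq' h.symm, eq_sub_of_add_eq' h'.symm]
    noncomm_ring
  have h6 : g - g' ∈ F k := by
    convert add_mem (hF.antitone (Nat.le_succ k) h5) (add_mem hxx hyy) using 1
    abel
  have h7 := flog_sub_flog_mem hι hF hg hg' h6
  rw [bch, bch, h, h']
  convert add_mem h7 h5 using 1
  abel

variable {θ : K} {P : A →ₗ[K] A}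

theorem smul_sub_mem (hP : ∀ (n : ℕ) (x : A), x ∈ F n → P x ∈ F n) {n : ℕ} {x : A}
    (hx : x ∈ F n) : θ • x - P x ∈ F n :=
  sub_mem (Submodule.smul_mem _ _ hx) (hP n x hx)

theorem chiStep_mem (hι : Function.Injective ι) (hF : IsCompleteFiltration F)
    (hP : ∀ (n : ℕ) (x : A), x ∈ F n → P x ∈ F n) {a c : A} (ha : a ∈ F 1) (hc : c ∈ F 1) :
    chiStep ι F θ P a c ∈ F 1 :=
  sub_mem ha (Submodule.smul_mem _ _ (bch_mem hι hF (hP 1 c hc) (smul_sub_mem hP hc)))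

/-- The recursion step is a contraction of `F 1`. -/
theorem chiStep_sub_chiStep_mem (hι : Function.Injective ι) (hF : IsCompleteFiltration F)
    (hP : ∀ (n : ℕ) (x : A), x ∈ F n → P x ∈ F n) (a : A) {c d : A} (hc : c ∈ F 1)
    (hd : d ∈ F 1) {k : ℕ} (h : c - d ∈ F k) :
    chiStep ι F θ P a c - chiStep ι F θ P a d ∈ F (k + 1) := by
  rw [chiStep, chiStep, sub_sub_sub_cancel_left, ← smul_sub]
  refine Submodule.smul_mem _ _ (bch_sub_bch_mem hι hF (hP 1 d hd) (smul_sub_mem hP hd)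
    (hP 1 c hc) (smul_sub_mem hP hc) ?_ ?_)
  · rw [← map_sub, ← neg_sub, map_neg]
    exact neg_mem (hP k _ h)
  · have : θ • d - P d - (θ • c - P c) = -(θ • (c - d) - P (c - d)) := by
      rw [smul_sub, map_sub]
      abel
    rw [this]
    exact neg_mem (smul_sub_mem hP h)

theorem chiIter_mem (hι : Function.Injective ι) (hF : IsCompleteFiltration F)
    (hP : ∀ (n : ℕ) (x : A), x ∈ F n → P x ∈ F n) {a : A} (ha : a ∈ F 1) (n : ℕ) :
    chiIter ι F θ P a n ∈ F 1 := by
  induction n with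
  | zero => exact ha
  | succ n ih => exact chiStep_mem hι hF hP ha ih

theorem chiIter_succ_sub_mem (hι : Function.Injective ι) (hF : IsCompleteFiltration F)
    (hP : ∀ (n : ℕ) (x : A), x ∈ F n → P x ∈ F n) {a : A} (ha : a ∈ F 1) (n : ℕ) :
    chiIter ι F θ P a (n + 1) - chiIter ι F θ P a n ∈ F (n + 1) := by
  induction n with
  | zero => exact sub_mem (chiIter_mem hι hF hP ha 1) ha
  | succ n ih =>
    exact chiStep_sub_chiStep_mem hι hF hP a (chiIter_mem hι hF hP ha _)
      (chiIter_mem hι hF hP ha _) ih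

theorem chi_spec (hι : Function.Injective ι) (hF : IsCompleteFiltration F)
    (hP : ∀ (n : ℕ) (x : A), x ∈ F n → P x ∈ F n) {a : A} (ha : a ∈ F 1) :
    FTendsto F (chiIter ι F θ P a) (chi ι F θ P a) := by
  refine Classical.epsilon_spec (p := fun l => FTendsto F (chiIter ι F θ P a) l) ?_
  obtain ⟨l, hl, -⟩ := hF.complete (chiIter ι F θ P a) fun n =>
    hF.antitone (Nat.le_succ n) (chiIter_succ_sub_mem hι hF hP ha n)
  exact ⟨l, fun k => ⟨k, fun n hn => hF.antitone hn (hl n)⟩⟩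

theorem chi_mem (hι : Function.Injective ι) (hF : IsCompleteFiltration F)
    (hP : ∀ (n : ℕ) (x : A), x ∈ F n → P x ∈ F n) {a : A} (ha : a ∈ F 1) :
    chi ι F θ P a ∈ F 1 := by
  obtain ⟨N, hN⟩ := chi_spec (θ := θ) hι hF hP ha 1
  have := add_mem (hN N le_rfl) (chiIter_mem (θ := θ) hι hF hP ha N)
  rwa [sub_add_cancel] at this

theorem chiStep_chi (hι : Function.Injective ι) (hF : IsCompleteFiltration F)
    (hP : ∀ (n : ℕ) (x : A), x ∈ F n → P x ∈ F n) {a : A} (ha : a ∈ F 1) :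
    chiStep ι F θ P a (chi ι F θ P a) = chi ι F θ P a := by
  refine sub_eq_zero.1 (hF.separated _ fun k => ?_)
  obtain ⟨N, hN⟩ := chi_spec (θ := θ) hι hF hP ha k
  have h1 := chiStep_sub_chiStep_mem (θ := θ) hι hF hP a (chi_mem hι hF hP ha)
    (chiIter_mem hι hF hP ha N) (hN N le_rfl)
  have := sub_mem (hF.antitone (Nat.le_succ k) h1) (hN (N + 1) (by omega))
  rwa [chiIter, sub_sub_sub_cancel_right] at this

theorem chiStep_fixed_iff (hι : Function.Injective ι) (hF : IsCompleteFiltration F)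
    (hP : ∀ (n : ℕ) (x : A), x ∈ F n → P x ∈ F n) {a c : A} (ha : a ∈ F 1) (hc : c ∈ F 1) :
    c = chiStep ι F θ P a c ↔ c = chi ι F θ P a := by
  refine ⟨fun h => sub_eq_zero.1 (hF.separated _ fun k => ?_), ?_⟩
  · induction k with
    | zero => exact hF.antitone (Nat.zero_le 1) (sub_mem hc (chi_mem hι hF hP ha))
    | succ k ih =>
      have := chiStep_sub_chiStep_mem (θ := θ) hι hF hP a hc (chi_mem hι hF hP ha) ih
      rwa [← h, chiStep_chi hι hF hP ha] at this
  · rintro rfl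
    exact (chiStep_chi hι hF hP ha).symm

/-- Multiplied by `θ`, the fixed point equation reads `log (exp (P c) * exp (P̃ c)) = θ a`;
exponentiate. -/
theorem fexp_mul_fexp_chi [CharZero K] (hι : Function.Injective ι)
    (hF : IsCompleteFiltration F) (hP : ∀ (n : ℕ) (x : A), x ∈ F n → P x ∈ F n) (hθ : θ ≠ 0)
    {a : A} (ha : a ∈ F 1) :
    fexp ι F (P (chi ι F θ P a)) * fexp ι F (θ • chi ι F θ P a - P (chi ι F θ P a)) =
      fexp ι F (θ • a) := by
  have hc := chi_mem (θ := θ) hι hF hP ha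
  have h := chiStep_chi (θ := θ) hι hF hP ha
  set c := chi ι F θ P a
  obtain ⟨g, hg, he⟩ := exists_fexp_mul_fexp hι hF (hP 1 c hc) (smul_sub_mem (θ := θ) hP hc)
  have h2 := congrArg (θ • ·) h
  simp only [chiStep, bch, smul_sub, smul_inv_smul₀ hθ] at h2
  have h3 : θ • a = flog ι F (1 + ι g) := by
    rw [← he]
    rw [← sub_eq_zero] at h2 ⊢
    rw [← h2]
    abel
  rw [h3, fexp_flog hι hF hg, he]

end Recursion

/-! ### The double product and the Spitzer series. -/

section Spitzer

variable {K A U : Type*} [Field K] [NonUnitalRing A] [Module K A] [Ring U] [Algebra K U]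
  {ι : A →ₙₐ[K] U} {F : ℕ → Submodule K A} {θ : K} {P : A →ₗ[K] A}

/-- The powers `c^{n+1}` for the Rota--Baxter double product `x P(y) + P(x) y - θ x y`. -/
def doublePow (θ : K) (P : A →ₗ[K] A) (c : A) : ℕ → A
  | 0 => c
  | n + 1 => doublePow θ P c n * P c + P (doublePow θ P c n) * c - θ • (doublePow θ P c n * c)

theorem doublePow_mem (hA : IsCompleteFilteredRotaBaxter θ P F) {c : A} (hc : c ∈ F 1) (n : ℕ) :
    doublePow θ P c n ∈ F (n + 1) := by
  induction n with
  | zero => exact hc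
  | succ n ih =>
    exact sub_mem (add_mem (hA.mul_mem ih (hA.map_mem 1 c hc)) (hA.mul_mem (hA.map_mem _ _ ih) hc))
      (Submodule.smul_mem _ _ (hA.mul_mem ih hc))

theorem map_P_doublePow (hP : IsRotaBaxter θ P) (c : A) (n : ℕ) :
    ι (P (doublePow θ P c n)) = ι (P c) ^ (n + 1) := by
  induction n with
  | zero => simp [doublePow]
  | succ n ih =>
    rw [pow_succ, ← ih, ← map_mul, doublePow, map_sub, map_add, ← hP, map_smul,
      add_sub_cancel_right]

/-- It is `-P̃`, not `P̃`, that respects the double product; hence the sign. -/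
theorem map_compl_doublePow [IsScalarTower K A A] [SMulCommClass K A A] (hP : IsRotaBaxter θ P)
    (c : A) (n : ℕ) :
    ι (θ • doublePow θ P c n - P (doublePow θ P c n)) =
      (-1 : K) ^ n • ι (θ • c - P c) ^ (n + 1) := by
  induction n with
  | zero => simp [doublePow]
  | succ n ih =>
    rw [pow_succ _ (n + 1), pow_succ _ n, mul_smul, smul_comm, ← smul_mul_assoc, ← ih, ← map_mul,
      ← map_smul]
    congr 1
    generalize hq : doublePow θ P c n = q
    have h1 : P (q * P c + P q * c - θ • (q * c)) = P q * P c := by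
      rw [map_sub, map_add, ← hP, map_smul, add_sub_cancel_right]
    rw [doublePow, hq, h1]
    simp only [sub_mul, mul_sub, smul_sub, smul_add, smul_mul_assoc, mul_smul_comm, neg_smul,
      one_smul]
    abel

/-- The double product exponential of `-c`, without its constant term, splits the exponentials
of `-P c` and `P̃ c`. -/
theorem exists_fexp_eq [IsScalarTower K A A] [SMulCommClass K A A] (hι : Function.Injective ι)
    (hA : IsCompleteFilteredRotaBaxter θ P F) {c : A} (hc : c ∈ F 1) :
    ∃ w ∈ F 1, fexp ι F (-P c) = 1 + ι (P w) ∧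
      fexp ι F (θ • c - P c) = 1 - ι (θ • w - P w) := by
  have hF := hA.toIsCompleteFiltration
  have hG := isMulFiltration_filtIn hι hF
  -- Partial sums of `exp (-c) - 1` for the double product; their limit is `w`.
  set s : ℕ → A := fun N => ∑ n ∈ Finset.range N,
    ((-1 : K) ^ (n + 1) * ((n + 1).factorial : K)⁻¹) • doublePow θ P c n with hs
  have hs1 : ∀ N, s N ∈ F 1 := fun N => Submodule.sum_mem _ fun n _ =>
    Submodule.smul_mem _ _ (hF.antitone (by omega) (doublePow_mem hA hc n))
  obtain ⟨w, hw, -⟩ := hF.complete s fun n => by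
    rw [hs]
    simp only [Finset.sum_range_succ, add_sub_cancel_left]
    exact Submodule.smul_mem _ _ (hF.antitone (by omega) (doublePow_mem hA hc n))
  have hw1 : w ∈ F 1 := by
    have := add_mem (hw 1) (hs1 1)
    rwa [sub_add_cancel] at this
  refine ⟨w, hw1, ?_, ?_⟩
  · rw [← sub_eq_iff_eq_add']
    refine (fexp_sub_one_tendsto hF (neg_mem (hA.map_mem 1 c hc))).unique hG.separated
      fun k => ⟨k, fun n hn => ?_⟩
    have h := map_mem_filtIn (ι := ι) (hA.map_mem k _ (hF.antitone hn (hw n)))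
    convert h using 1
    rw [map_sub, map_sub, hs]
    simp only [map_sum, map_smul, map_P_doublePow hA.rotaBaxter, map_neg]
    congr 1
    refine Finset.sum_congr rfl fun i _ => ?_
    rw [neg_pow, mul_comm ((-1 : K) ^ (i + 1)), mul_smul]
    congr 1
    rw [Algebra.smul_def]
    simp
  · rw [sub_eq_add_neg (1 : U), ← sub_eq_iff_eq_add']
    refine (fexp_sub_one_tendsto hF (smul_sub_mem hA.map_mem hc)).unique hG.separated
      fun k => ⟨k, fun n hn => ?_⟩
    have h := neg_mem (map_mem_filtIn (ι := ι)
      (smul_sub_mem (θ := θ) hA.map_mem (hF.antitone hn (hw n))))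
    convert h using 1
    have e : ι (θ • s n - P (s n)) = -∑ i ∈ Finset.range n,
        (((i + 1).factorial : K)⁻¹) • ι (θ • c - P c) ^ (i + 1) := by
      rw [hs]
      simp only [map_sum, Finset.smul_sum, ← Finset.sum_sub_distrib, ← Finset.sum_neg_distrib]
      refine Finset.sum_congr rfl fun i _ => ?_
      rw [map_smul, smul_comm θ, ← smul_sub, map_smul ι, map_compl_doublePow hA.rotaBaxter,
        smul_smul, ← neg_smul]
      congr 1
      have : (-1 : K) ^ i * (-1) ^ i = 1 := by rw [← mul_pow]; simp
      rw [pow_succ]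
      linear_combination (-((i + 1).factorial : K)⁻¹) * this
    have e2 : θ • (w - s n) - P (w - s n) = (θ • w - P w) - (θ • s n - P (s n)) := by
      rw [smul_sub, map_sub]
      abel
    rw [e2, map_sub ι (θ • w - P w), e]
    abel

/-- The solution of `p = -P(b) - P(p b)` is the series `∑_{n ≥ 1} (-1)ⁿ P(⋯P(P(b) b)⋯b)`. -/
theorem spitzer_series_tendsto (hA : IsCompleteFilteredRotaBaxter θ P F) {b p : A}
    (hb : b ∈ F 1) (hp : p ∈ F 1) (h : p = -P b - P (p * b)) :
    FTendsto (filtIn ι F)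
      (fun N => ∑ n ∈ Finset.range N, (-1 : U) ^ n * spitzerTerm ι P b n) (1 + ι p) := by
  -- Up to sign, the remainder solves the same equation with `nestedP P b N` in place of `P b`, and
  -- its degree grows with `N`.
  have key : ∀ N, ∃ r ∈ F (N + 1), 1 + ι p - ∑ n ∈ Finset.range (N + 1),
      (-1 : U) ^ n * spitzerTerm ι P b n = (-1 : U) ^ N * ι r ∧
      r = -nestedP P b N - P (r * b) := by
    intro N
    induction N with
    | zero => exact ⟨p, hp, by simp [spitzerTerm], h⟩
    | succ N ih =>
      obtain ⟨r, hr, h1, h2⟩ := ih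
      refine ⟨P (r * b), hA.map_mem _ _ (hA.mul_mem hr hb), ?_, ?_⟩
      · rw [Finset.sum_range_succ, ← sub_sub, h1, spitzerTerm]
        have : ι (P (r * b)) = -ι (nestedP P b N) - ι r := by
          rw [← map_neg, ← map_sub]
          congr 1
          rw [← sub_eq_zero]
          rw [← sub_eq_zero] at h2
          rw [← h2]
          abel
        rw [this, pow_succ]
        noncomm_ring
      · rw [nestedP, ← map_neg, ← map_sub, ← neg_mul, ← sub_mul, ← h2]
  intro k
  refine ⟨k + 1, fun n hn => ?_⟩
  obtain ⟨m, rfl⟩ : ∃ m, n = m + 1 := ⟨n - 1, by omega⟩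
  obtain ⟨r, hr, h1, -⟩ := key m
  rw [h1]
  have hr' := map_mem_filtIn (ι := ι) (hA.antitone (show k ≤ m + 1 by omega) hr)
  rcases neg_one_pow_eq_or U m with h | h <;> rw [h]
  · rwa [one_mul]
  · rw [neg_one_mul]
    exact neg_mem hr'

end Spitzer

end RotaBaxterSpitzer

theorem mainTheorem9 {K A U : Type*} [Field K] [CharZero K]
    [NonUnitalRing A] [Module K A] [IsScalarTower K A A] [SMulCommClass K A A]
    [Ring U] [Algebra K U] (ι : A →ₙₐ[K] U) (hι : Function.Injective ι)
    (θ : K) (hθ : θ ≠ 0) (P : A →ₗ[K] A) (F : ℕ → Submodule K A)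
    (hA : RotaBaxterSpitzer.IsCompleteFilteredRotaBaxter θ P F) :
    (∀ a ∈ F 1,
      RotaBaxterSpitzer.FTendsto F (RotaBaxterSpitzer.chiIter ι F θ P a)
        (RotaBaxterSpitzer.chi ι F θ P a) ∧
      RotaBaxterSpitzer.chi ι F θ P a ∈ F 1 ∧
      ∀ c ∈ F 1, c = a - θ⁻¹ • RotaBaxterSpitzer.bch ι F (P c) (θ • c - P c) ↔
        c = RotaBaxterSpitzer.chi ι F θ P a) ∧
    ∀ b ∈ F 1,
      RotaBaxterSpitzer.FTendsto (RotaBaxterSpitzer.filtIn ι F)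
        (fun N => ∑ n ∈ Finset.range N,
          (-1 : U) ^ n * RotaBaxterSpitzer.spitzerTerm ι P b n)
        (RotaBaxterSpitzer.fexp ι F
          (-P (RotaBaxterSpitzer.chi ι F θ P
            (θ⁻¹ • RotaBaxterSpitzer.flog ι F (1 + θ • ι b))))) := by
  have hF := hA.toIsCompleteFiltration
  have hP := hA.map_mem
  refine ⟨fun a ha => ⟨RotaBaxterSpitzer.chi_spec hι hF hP ha,
    RotaBaxterSpitzer.chi_mem hι hF hP ha,
    fun c hc => RotaBaxterSpitzer.chiStep_fixed_iff hι hF hP ha hc⟩, fun b hb => ?_⟩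
  have hθb : θ • b ∈ F 1 := Submodule.smul_mem _ _ hb
  rw [← map_smul]
  have ha : θ⁻¹ • RotaBaxterSpitzer.flog ι F (1 + ι (θ • b)) ∈ F 1 :=
    Submodule.smul_mem _ _ (RotaBaxterSpitzer.flog_mem hι hF hθb)
  have hc := RotaBaxterSpitzer.chi_mem (θ := θ) hι hF hP ha
  have hmul := RotaBaxterSpitzer.fexp_mul_fexp_chi hι hF hP hθ ha
  rw [smul_inv_smul₀ hθ, RotaBaxterSpitzer.fexp_flog hι hF hθb] at hmul
  set c := RotaBaxterSpitzer.chi ι F θ P (θ⁻¹ • RotaBaxterSpitzer.flog ι F (1 + ι (θ • b)))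
  obtain ⟨w, hw, h1, h2⟩ := RotaBaxterSpitzer.exists_fexp_eq hι hA hc
  -- Moving `exp (P c)` to the other side makes the equation linear in `w`.
  have h3 := congrArg (RotaBaxterSpitzer.fexp ι F (-P c) * ·) hmul
  simp only [← mul_assoc, RotaBaxterSpitzer.fexp_neg_mul_fexp hι hF (hP 1 c hc), one_mul] at h3
  rw [h2, h1] at h3
  have h4 : θ • w = θ • (-b - P w * b) := by
    apply hι
    rw [smul_sub, smul_neg, ← mul_smul_comm, map_sub, map_neg, map_mul]
    rw [map_sub, add_mul, one_mul, mul_add, mul_one, ← sub_eq_zero] at h3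
    rw [← sub_eq_zero, ← neg_eq_zero, ← h3]
    abel
  have h5 : w = -b - P w * b := smul_right_injective A hθ h4
  rw [h1]
  refine RotaBaxterSpitzer.spitzer_series_tendsto hA hb (hP 1 w hw) ?_
  rw [← map_neg, ← map_sub, ← h5]
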